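/- For $q\ge 0$, a partial permutation of $\{1,\dots,q\}$ is a pair $(d,w)$ with $d\subseteq\{1,\dots,q\}$ and $w$ a bijection of $\{1,\dots,q\}$ with $w(x)=x$ for $x\notin d$; the product is $(d_1,w_1)(d_2,w_2)=(d_1\cup d_2,w_1w_2)$. Let $\mathbb{C}(\mathcal{S}_q)$ be the algebra of this semigroup, and let $\mathbb{C}(\mathcal{S}_\infty)$ be the projective limit of these algebras with respect to the morphisms $\theta:\mathbb{C}(\mathcal{S}_r)\to\mathbb{C}(\mathcal{S}_q)$, $q\le r$, which send $(d,w)$ to $(d,w)$ if $d\subseteq\{1,\dots,q\}$ and to $0$ otherwise. Let $\ast$ be an extra element. The moment $M^{JM}_k$ ($k\ge 0$) of the Jucys--Murphy element $J=\sum_{a=1}^{q}(a\,\ast)$ is the element of $\mathbb{C}(\mathcal{S}_\infty)$ whose component in $\mathbb{C}(\mathcal{S}_q)$ is the sum of the partial permutations $\big(\{a_1,\dots,a_k\},(a_1\,\ast)\cdots(a_k\,\ast)\big)$ over all $a_1,\dots,a_k\in\{1,\dots,q\}$ such that the product $(a_1\,\ast)\cdots(a_k\,\ast)$ fixes $\ast$.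 These elements commute; let $\mathfrak{P}\subseteq\mathbb{C}(\mathcal{S}_\infty)$ be the commutative unital $\mathbb{C}$-algebra which they generate. The free cumulants are $$R^{JM}_n=\sum_{\rho\in NC(1,\dots,n)}\mathrm{Moeb}_{\rho_{\mathrm{comp}}}\prod_{B\in\rho}M^{JM}_{|B|}\in\mathfrak{P},\qquad \mathrm{Moeb}_\sigma=\prod_{B\in\sigma}(-1)^{|B|-1}c_{|B|-1},$$ where $NC(1,\dots,n)$ is the set of non-crossing partitions of $\{1,\dots,n\}$, $\rho_{\mathrm{comp}}$ is the Kreweras complement of $\rho$, and $c_k=\frac{(2k)!}{(k+1)!\,k!}$. Then the elements $(R^{JM}_k)_{k\ge 2}$ are algebraically independent over $\mathbb{C}$, and so are the elements $(M^{JM}_k)_{k\ge 2}$. Hence the gradation $\deg M^{JM}_k=k$ on $\mathfrak{P}$ is well defined: there is exactly one family $(\mathfrak{P}_d)_{d\ge 0}$ of linear subspaces of $\mathfrak{P}$ with $\mathfrak{P}=\bigoplus_{d\ge0}\mathfrak{P}_d$, $1\in\mathfrak{P}_0$ and $\mathfrak{P}_d\mathfrak{P}_e\subseteq\mathfrak{P}_{d+e}$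 such that $0\ne M^{JM}_k\in\mathfrak{P}_k$ for all $k\ge 2$. -/

import Mathlib

open Finset

/-- A partial permutation `(d, w)` of the set `{1, …, q}`: a subset `d ⊆ {1, …, q}` and a
bijection `w` with `w x = x` for `x ∉ d`. The bijection is recorded as a permutation of `ℕ`;
by `perm_eq` it is determined by, and can be any, bijection of `{1, …, q}` that is trivial
off `d`. -/
@[ext]
structure PartialPerm (q : ℕ) where
  support : Finset ℕ
  perm : Equiv.Perm ℕ
  support_subset : support ⊆ Icc 1 q
  perm_eq : ∀ x, x ∉ support → perm x = x

namespace PartialPerm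

variable {q : ℕ}

instance : One (PartialPerm q) := ⟨⟨∅, 1, by simp, by simp⟩⟩

instance : Mul (PartialPerm q) :=
  ⟨fun α β => ⟨α.support ∪ β.support, α.perm * β.perm,
    union_subset α.support_subset β.support_subset, by
      intro x hx
      rw [mem_union, not_or] at hx
      rw [Equiv.Perm.mul_apply, β.perm_eq x hx.2, α.perm_eq x hx.1]⟩⟩

@[simp] theorem one_support : (1 : PartialPerm q).support = ∅ := rfl
@[simp] theorem one_perm : (1 : PartialPerm q).perm = 1 := rfl
@[simp] theorem mul_support (α β : PartialPerm q) :
    (α * β).support = α.support ∪ β.support := rfl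
@[simp] theorem mul_perm (α β : PartialPerm q) : (α * β).perm = α.perm * β.perm := rfl

instance : Monoid (PartialPerm q) where
  one_mul α := by ext1 <;> simp
  mul_one α := by ext1 <;> simp
  mul_assoc α β γ := by ext1 <;> simp [mul_assoc]

theorem perm_mem_iff (α : PartialPerm q) (x : ℕ) : α.perm x ∈ α.support ↔ x ∈ α.support := by
  constructor
  · intro h
    by_contra hx
    rw [α.perm_eq x hx] at h
    exact hx h
  · intro h
    by_contra hx
    have h1 := α.perm_eq _ hx
    have h2 := α.perm.injective h1
    rw [h2] at hx
    exact hx h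

theorem perm_mem_Icc_iff (α : PartialPerm q) (x : ℕ) : α.perm x ∈ Icc 1 q ↔ x ∈ Icc 1 q := by
  by_cases hx : x ∈ α.support
  · exact iff_of_true (α.support_subset ((α.perm_mem_iff x).2 hx)) (α.support_subset hx)
  · rw [α.perm_eq x hx]

theorem perm_zero (α : PartialPerm q) : α.perm 0 = 0 :=
  α.perm_eq 0 fun h => by simpa using α.support_subset h

end PartialPerm

/-- The algebra `ℂ(S_q)` of the semigroup of partial permutations of `{1, …, q}`. -/
abbrev PartialPermAlgebra (q : ℕ) : Type := MonoidAlgebra ℂ (PartialPerm q)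

noncomputable section

/-- On partial permutations, `θ` keeps `(d, w)` if `d ⊆ {1, …, q}` and kills it otherwise. -/
def thetaMonoidHom (q r : ℕ) : PartialPerm r →* PartialPermAlgebra q where
  toFun α := if h : α.support ⊆ Icc 1 q then
    MonoidAlgebra.single ⟨α.support, α.perm, h, α.perm_eq⟩ 1 else 0
  map_one' := by
    simp only [PartialPerm.one_support, empty_subset, dite_true]
    rfl
  map_mul' α β := by
    by_cases h1 : α.support ⊆ Icc 1 q <;> by_cases h2 : β.support ⊆ Icc 1 q
    · simp only [PartialPerm.mul_support, PartialPerm.mul_perm, union_subset_iff, h1, h2,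
        and_self, dite_true, MonoidAlgebra.single_mul_single, mul_one]
      rfl
    all_goals simp [union_subset_iff, h1, h2]

/-- The morphism `θ : ℂ(S_r) → ℂ(S_q)`, used for `q ≤ r`. -/
def theta (q r : ℕ) : PartialPermAlgebra r →ₐ[ℂ] PartialPermAlgebra q :=
  MonoidAlgebra.lift ℂ (PartialPermAlgebra q) (PartialPerm r) (thetaMonoidHom q r)

/-- The algebra `ℂ(S_∞)`: the projective limit of the algebras `ℂ(S_q)` along the morphisms
`θ`, realized as the algebra of compatible sequences. -/
def PartialPermAlgebraInfty : Subalgebra ℂ (∀ q : ℕ, PartialPermAlgebra q) where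
  carrier := {f | ∀ q r : ℕ, q ≤ r → theta q r (f r) = f q}
  mul_mem' {f g} hf hg q r h := by simp [hf q r h, hg q r h]
  add_mem' {f g} hf hg q r h := by simp [hf q r h, hg q r h]
  algebraMap_mem' c q r _ := by
    rw [Pi.algebraMap_apply, Pi.algebraMap_apply, AlgHom.commutes]

/-! ### Moments of the Jucys--Murphy element

The distinguished element `*` outside `{1, …, q}` is `0`. -/

/-- The product of transpositions `(a₁ *) ⋯ (a_k *)`. -/
def jmProd {k : ℕ} (a : Fin k → ℕ) : Equiv.Perm ℕ :=
  (List.ofFn fun i => Equiv.swap (a i) 0).prod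

theorem jmProd_eq_self {k : ℕ} (a : Fin k → ℕ) (h0 : jmProd a 0 = 0) (x : ℕ)
    (hx : x ∉ univ.image a) : jmProd a x = x := by
  by_cases h : x = 0
  · rw [h, h0]
  · have key : ∀ l : List (Equiv.Perm ℕ), (∀ w ∈ l, w x = x) → l.prod x = x := by
      intro l
      induction l with
      | nil => intro _; rfl
      | cons w l ih =>
        intro hl
        rw [List.prod_cons, Equiv.Perm.mul_apply, ih fun v hv => hl v (List.mem_cons_of_mem _ hv)]
        exact hl w List.mem_cons_self
    refine key _ fun w hw => ?_
    rw [List.mem_ofFn] at hw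
    obtain ⟨i, rfl⟩ := hw
    refine Equiv.swap_apply_of_ne_of_ne ?_ h
    rintro rfl
    exact hx (mem_image_of_mem a (mem_univ i))

/-- The summand `𝔼[(a₁ *) ⋯ (a_k *)]`, as an element of `ℂ(S_q)`: if the product fixes `*` it is
the product with support `{a₁, …, a_k}`, otherwise it is zero. -/
def jmTerm (q : ℕ) {k : ℕ} (a : Fin k → ℕ) : PartialPermAlgebra q :=
  if h : univ.image a ⊆ Icc 1 q ∧ jmProd a 0 = 0 then
    MonoidAlgebra.single ⟨univ.image a, jmProd a, h.1, jmProd_eq_self a h.2⟩ 1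
  else 0

/-- The moment `M_k = 𝔼(J^k) ∈ ℂ(S_q)`, the sum of `𝔼[(a₁ *) ⋯ (a_k *)]` over all
`a₁, …, a_k ∈ {1, …, q}`. -/
def jmMomentFin (q k : ℕ) : PartialPermAlgebra q :=
  ∑ a ∈ Fintype.piFinset fun _ : Fin k => Icc 1 q, jmTerm q a

theorem theta_jmTerm {q r k : ℕ} (hqr : q ≤ r) (a : Fin k → ℕ) :
    theta q r (jmTerm r a) = jmTerm q a := by
  have hsub : Icc 1 q ⊆ Icc 1 r := Icc_subset_Icc_right hqr
  unfold jmTerm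
  by_cases h0 : jmProd a 0 = 0
  · by_cases h1 : univ.image a ⊆ Icc 1 r
    · rw [dif_pos ⟨h1, h0⟩]
      by_cases h2 : univ.image a ⊆ Icc 1 q
      · rw [dif_pos ⟨h2, h0⟩]
        simp [theta, thetaMonoidHom, MonoidAlgebra.lift_single, h2]
      · rw [dif_neg fun h => h2 h.1]
        simp [theta, thetaMonoidHom, MonoidAlgebra.lift_single, h2]
    · rw [dif_neg fun h => h1 h.1, dif_neg fun h => h1 (h.1.trans hsub), map_zero]
  · rw [dif_neg fun h => h0 h.2, dif_neg fun h => h0 h.2, map_zero]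

theorem theta_jmMomentFin {q r : ℕ} (hqr : q ≤ r) (k : ℕ) :
    theta q r (jmMomentFin r k) = jmMomentFin q k := by
  have hsub : Icc 1 q ⊆ Icc 1 r := Icc_subset_Icc_right hqr
  unfold jmMomentFin
  rw [map_sum, sum_congr rfl fun a _ => theta_jmTerm hqr a]
  symm
  refine sum_subset (Fintype.piFinset_subset _ _ fun _ => hsub) fun a _ ha => ?_
  unfold jmTerm
  rw [dif_neg]
  rintro ⟨h, -⟩
  refine ha (Fintype.mem_piFinset.2 fun i => h (mem_image_of_mem a (mem_univ i)))

/-- The moment `M_k ∈ ℂ(S_∞)` of the Jucys--Murphy element. -/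
def jmMomentInfty (k : ℕ) : PartialPermAlgebraInfty :=
  ⟨fun q => jmMomentFin q k, fun _ _ h => theta_jmMomentFin h k⟩

theorem jmProd_conj {k : ℕ} (w : Equiv.Perm ℕ) (hw : w 0 = 0) (a : Fin k → ℕ) :
    jmProd (fun i => w (a i)) = w * jmProd a * w⁻¹ := by
  unfold jmProd
  have h : (List.ofFn fun i => Equiv.swap (w (a i)) 0) =
      (List.ofFn fun i => Equiv.swap (a i) 0).map (MulAut.conj w) := by
    rw [List.map_ofFn]
    congr 1
    funext i
    conv_lhs => rw [← hw]
    simp [Function.comp, MulAut.conj_apply, Equiv.swap_apply_apply]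
  rw [h, ← map_list_prod, MulAut.conj_apply]

theorem single_mul_jmTerm {q k : ℕ} (α : PartialPerm q) (a : Fin k → ℕ) :
    (MonoidAlgebra.single α 1 : PartialPermAlgebra q) * jmTerm q a =
      jmTerm q (fun i => α.perm (a i)) * MonoidAlgebra.single α 1 := by
  have himg : univ.image (fun i => α.perm (a i)) = (univ.image a).image α.perm := by
    rw [image_image]; rfl
  have hconj := jmProd_conj α.perm α.perm_zero a
  have hinv : α.perm⁻¹ 0 = 0 := by
    rw [Equiv.Perm.inv_eq_iff_eq, α.perm_zero]
  have hsub : univ.image (fun i => α.perm (a i)) ⊆ Icc 1 q ↔ univ.image a ⊆ Icc 1 q := by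
    rw [himg, image_subset_iff]
    exact forall₂_congr fun x _ => α.perm_mem_Icc_iff x
  have hzero : jmProd (fun i => α.perm (a i)) 0 = 0 ↔ jmProd a 0 = 0 := by
    rw [hconj, Equiv.Perm.mul_apply, Equiv.Perm.mul_apply, hinv]
    conv_lhs => rw [← α.perm_zero]
    rw [α.perm.injective.eq_iff, α.perm_zero]
  by_cases h : univ.image a ⊆ Icc 1 q ∧ jmProd a 0 = 0
  · unfold jmTerm
    rw [dif_pos h, dif_pos ⟨hsub.2 h.1, hzero.2 h.2⟩, MonoidAlgebra.single_mul_single,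
      MonoidAlgebra.single_mul_single]
    congr 1
    ext1
    · simp only [PartialPerm.mul_support, himg]
      ext x
      simp only [mem_union]
      by_cases hx : x ∈ α.support
      · simp [hx]
      · have : x ∈ (univ.image a).image α.perm ↔ x ∈ univ.image a := by
          conv_lhs => rw [← α.perm_eq x hx]
          exact α.perm.injective.mem_finset_image
        rw [this]
        exact or_comm
    · simp only [PartialPerm.mul_perm, hconj]
      group
  · unfold jmTerm
    rw [dif_neg h, dif_neg fun h' => h ⟨hsub.1 h'.1, hzero.1 h'.2⟩, mul_zero, zero_mul]

theorem jmMomentFin_commute (q k : ℕ) (x : PartialPermAlgebra q) :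
    Commute x (jmMomentFin q k) := by
  induction x using MonoidAlgebra.induction_linear with
  | zero => exact Commute.zero_left _
  | add f g hf hg => exact hf.add_left hg
  | single α c =>
    have h1 : Commute (MonoidAlgebra.single α 1 : PartialPermAlgebra q) (jmMomentFin q k) := by
      unfold Commute SemiconjBy jmMomentFin
      rw [mul_sum, sum_mul]
      refine sum_bij (fun a _ i => α.perm (a i)) ?_ ?_ ?_ ?_
      · intro a ha
        rw [Fintype.mem_piFinset] at ha ⊢
        exact fun i => (α.perm_mem_Icc_iff _).2 (ha i)
      · intro a _ b _ hab
        funext i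
        exact α.perm.injective (congrFun hab i)
      · intro b hb
        rw [Fintype.mem_piFinset] at hb
        refine ⟨fun i => α.perm⁻¹ (b i), ?_, ?_⟩
        · rw [Fintype.mem_piFinset]
          intro i
          rw [← α.perm_mem_Icc_iff]
          simpa using hb i
        · funext i
          simp
      · intro a _
        exact single_mul_jmTerm α a
    have h2 : (MonoidAlgebra.single α c : PartialPermAlgebra q) =
        c • MonoidAlgebra.single α 1 := by
      rw [MonoidAlgebra.smul_single, smul_eq_mul, mul_one]
    rw [h2]
    exact h1.smul_left c

theorem jmMomentInfty_commute (k l : ℕ) :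
    jmMomentInfty k * jmMomentInfty l = jmMomentInfty l * jmMomentInfty k :=
  Subtype.ext (funext fun q => jmMomentFin_commute q l (jmMomentFin q k))

/-- The algebra `𝔓 ⊆ ℂ(S_∞)` generated by the moments of the Jucys--Murphy element. -/
def jmAlgebra : Subalgebra ℂ PartialPermAlgebraInfty :=
  Algebra.adjoin ℂ (Set.range jmMomentInfty)

theorem jmAlgebra_isMulCommutative : IsMulCommutative jmAlgebra :=
  Algebra.isMulCommutative_adjoin ℂ (s := Set.range jmMomentInfty) (by
    rintro _ ⟨k, rfl⟩ _ ⟨l, rfl⟩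
    exact jmMomentInfty_commute k l)

instance : CommRing jmAlgebra :=
  { jmAlgebra.toRing with mul_comm := jmAlgebra_isMulCommutative.is_comm.comm }

/-- The moment `M_k`, as an element of the commutative algebra `𝔓`. -/
def jmMoment (k : ℕ) : jmAlgebra :=
  ⟨jmMomentInfty k, Algebra.subset_adjoin (Set.mem_range_self k)⟩

/-! ### Non-crossing partitions and free cumulants -/

/-- A relation on a linearly ordered set is non-crossing if there are no `a < b < c < d` with
`a, c` connected and `b, d` connected, unless all four are connected. -/
def NonCrossingRel {X : Type*} [LinearOrder X] (R : X → X → Prop) : Prop :=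
  ∀ a b c d : X, a < b → b < c → c < d → R a c → R b d → R a b

/-- Two elements are connected by a partition if they lie in the same block. -/
def Connected {n : ℕ} (π : Finpartition (univ : Finset (Fin n))) (i j : Fin n) : Prop :=
  ∃ B ∈ π.parts, i ∈ B ∧ j ∈ B

/-- A partition is non-crossing if its relation of lying in the same block is. -/
def NonCrossing {n : ℕ} (π : Finpartition (univ : Finset (Fin n))) : Prop :=
  NonCrossingRel (Connected π)

/-- The relation `π ∪ σ` on `1 < 1' < 2 < 2' < ⋯ < n < n'`, with `π` on the points `i`, written
`(i, false)`, and `σ` on the points `i'`, written `(i, true)`. -/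
def InterleavedRel {n : ℕ} (π σ : Finpartition (univ : Finset (Fin n)))
    (x y : Fin n ×ₗ Bool) : Prop :=
  ((ofLex x).2 = false ∧ (ofLex y).2 = false ∧ Connected π (ofLex x).1 (ofLex y).1) ∨
    ((ofLex x).2 = true ∧ (ofLex y).2 = true ∧ Connected σ (ofLex x).1 (ofLex y).1)

theorem connected_refl {n : ℕ} (π : Finpartition (univ : Finset (Fin n))) (i : Fin n) :
    Connected π i i := by
  obtain ⟨B, hB, hi⟩ := π.exists_mem (mem_univ i)
  exact ⟨B, hB, hi, hi⟩

theorem Connected.symm {n : ℕ} {π : Finpartition (univ : Finset (Fin n))} {i j : Fin n}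
    (h : Connected π i j) : Connected π j i := by
  obtain ⟨B, hB, hi, hj⟩ := h
  exact ⟨B, hB, hj, hi⟩

/-- The equivalence relation of the Kreweras complement of `π`: the points `i'` and `j'` are
connected if the chord joining them separates no two points connected by `π`, that is, if
connected points are on the same side of `i'` exactly when they are on the same side of `j'`
(the point `a` comes before `i'` if and only if `a ≤ i`). -/
def krewerasSetoid {n : ℕ} (π : Finpartition (univ : Finset (Fin n))) : Setoid (Fin n) where
  r i j := ∀ a b, Connected π a b → ((a ≤ i ↔ b ≤ i) ↔ (a ≤ j ↔ b ≤ j))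
  iseqv :=
    { refl := fun _ _ _ _ => Iff.rfl
      symm := fun h a b hab => (h a b hab).symm
      trans := fun h h' a b hab => (h a b hab).trans (h' a b hab) }

open scoped Classical in
/-- The Kreweras complement of a (non-crossing) partition `π`, regarded as a partition of
`{1, …, n}` through `i' ↦ i`. -/
def kreweras {n : ℕ} (π : Finpartition (univ : Finset (Fin n))) :
    Finpartition (univ : Finset (Fin n)) :=
  Finpartition.ofSetoid (krewerasSetoid π)

theorem connected_kreweras_iff {n : ℕ} (π : Finpartition (univ : Finset (Fin n)))
    (i j : Fin n) : Connected (kreweras π) i j ↔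
      ∀ a b, Connected π a b → ((a ≤ i ↔ b ≤ i) ↔ (a ≤ j ↔ b ≤ j)) := by
  classical
  have h : Connected (kreweras π) i j ↔ j ∈ (kreweras π).part i := by
    rw [Finpartition.mem_part_iff_exists]
    exact ⟨fun ⟨B, hB, h1, h2⟩ => ⟨B, hB, h2, h1⟩, fun ⟨B, hB, h1, h2⟩ => ⟨B, hB, h2, h1⟩⟩
  rw [h]
  unfold kreweras
  rw [Finpartition.mem_part_ofSetoid_iff_rel]
  rfl

theorem le_of_connected_imp {n : ℕ} {π σ : Finpartition (univ : Finset (Fin n))}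
    (h : ∀ i j, Connected π i j → Connected σ i j) : π ≤ σ := by
  intro B hB
  obtain ⟨i, hi⟩ := π.nonempty_of_mem_parts hB
  obtain ⟨C, hC, hiC⟩ := σ.exists_mem (mem_univ i)
  refine ⟨C, hC, fun j hj => ?_⟩
  obtain ⟨D, hD, hiD, hjD⟩ := h i j ⟨B, hB, hi, hj⟩
  rwa [σ.disjoint.elim_finset hC hD i hiC hiD]

/-- The Kreweras complement of a non-crossing `π` is the biggest partition `σ` of
`{1', …, n'}` such that `π ∪ σ` is a non-crossing partition of `{1, 1', …, n, n'}`. -/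
theorem kreweras_isGreatest {n : ℕ} (π : Finpartition (univ : Finset (Fin n)))
    (hπ : NonCrossing π) :
    IsGreatest {σ | NonCrossingRel (InterleavedRel π σ)} (kreweras π) := by
  have htf : ¬ (true < false) := by decide
  constructor
  · intro x y z w hxy hyz hzw hxz hyw
    induction x using Lex.rec with | _ x
    induction y using Lex.rec with | _ y
    induction z using Lex.rec with | _ z
    induction w using Lex.rec with | _ w
    obtain ⟨x, u⟩ := x
    obtain ⟨y, v⟩ := y
    obtain ⟨z, u'⟩ := z
    obtain ⟨w, v'⟩ := w
    simp only [InterleavedRel, ofLex_toLex, Prod.Lex.toLex_lt_toLex,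
      connected_kreweras_iff] at *
    rcases hxz with ⟨rfl, rfl, h1⟩ | ⟨rfl, rfl, h1⟩ <;>
      rcases hyw with ⟨rfl, rfl, h2⟩ | ⟨rfl, rfl, h2⟩
    · simp at hxy hyz hzw
      simpa using hπ x y z w hxy hyz hzw h1 h2
    · have := h2 x z h1
      simp at hxy hyz hzw
      grind
    · have := h1 y w h2
      simp at hxy hyz hzw
      grind
    · simp at hxy hyz hzw
      simp only [reduceCtorEq, false_and, true_and, false_or]
      intro a b hab
      have h3 := h1 a b hab
      have h4 := h2 a b hab
      grind
  · intro σ hσ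
    refine le_of_connected_imp fun i j hij => ?_
    rw [connected_kreweras_iff]
    have key : ∀ i j, i < j → Connected σ i j → ∀ a b, a ≤ b → Connected π a b →
        ((a ≤ i ↔ b ≤ i) ↔ (a ≤ j ↔ b ≤ j)) := by
      intro i j hlt hij a b hle hab
      by_contra hne
      by_cases h : a ≤ i
      · have := hσ (toLex (a, false)) (toLex (i, true)) (toLex (b, false)) (toLex (j, true))
          (by simp [Prod.Lex.toLex_lt_toLex]; grind) (by simp [Prod.Lex.toLex_lt_toLex]; grind)
          (by simp [Prod.Lex.toLex_lt_toLex]; grind)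
          (by simp [InterleavedRel, hab]) (by simp [InterleavedRel, hij])
        simp [InterleavedRel] at this
      · have := hσ (toLex (i, true)) (toLex (a, false)) (toLex (j, true)) (toLex (b, false))
          (by simp [Prod.Lex.toLex_lt_toLex]; grind) (by simp [Prod.Lex.toLex_lt_toLex]; grind)
          (by simp [Prod.Lex.toLex_lt_toLex]; grind)
          (by simp [InterleavedRel, hij]) (by simp [InterleavedRel, hab])
        simp [InterleavedRel] at this
    intro a b hab
    rcases lt_trichotomy i j with h | rfl | h <;> rcases le_total a b with h' | h'
    · exact key i j h hij a b h' hab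
    · have := key i j h hij b a h' hab.symm
      grind
    · rfl
    · rfl
    · exact (key j i h hij.symm a b h' hab).symm
    · have := key j i h hij.symm b a h' hab.symm
      grind

/-- The Möbius function `∏ (-1)^(|B|-1) c_{|B|-1}`, the product over the blocks `B` of `σ`, with
`c_k` the Catalan numbers. -/
def moebNC {n : ℕ} (σ : Finpartition (univ : Finset (Fin n))) : ℤ :=
  ∏ B ∈ σ.parts, (-1) ^ (#B - 1) * (catalan (#B - 1) : ℤ)

open scoped Classical in
/-- The free cumulant `R_n = ∑ Moeb(ρ_comp) M_ρ` of a sequence of moments, the sum over the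
non-crossing partitions `ρ` of `{1, …, n}`, where `M_ρ` is the product of the `M_{|B|}` over
the blocks `B` of `ρ`. -/
def freeCumulant {V : Type*} [CommRing V] (M : ℕ → V) (n : ℕ) : V :=
  ∑ ρ : Finpartition (univ : Finset (Fin n)) with NonCrossing ρ,
    moebNC (kreweras ρ) • ∏ B ∈ ρ.parts, M #B

/-- The free cumulant `R_k ∈ 𝔓` of the Jucys--Murphy element. -/
def jmCumulant (k : ℕ) : jmAlgebra := freeCumulant jmMoment k

end

/-! ### Star transpositions and cycles -/

/-! Filter `jmAlgebra` by the size of supports. A tuple of n + 1 letters whose star transpositions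
multiply to a permutation fixing `*` has at most n distinct letters, and it has exactly n only if
the product is an n-cycle on them (`card_image_le_of_jmProd_fixes`). So M_{n+1} is led, in degree n,
by n-cycles with non-negative coefficients (`hasLead_jmMoment`). In a product, top degree arises
only from leading terms with disjoint supports. There cycle types add up, and positivity excludes
cancellation (`HasLead.mul`). Distinct monomials in the M_k, k ≥ 2, therefore have leading terms of
distinct cycle types, which gives independence (`algebraicIndependent_of_hasLead`). In R_{n+1} the
one-block partition contributes M_{n+1} and every other partition has degree below n
(`exists_jmCumulant_eq`), so the same argument covers the cumulants. Since M_0 = 1 and M_1 = 0, the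
algebra is a polynomial ring in the M_k, k ≥ 2. The weighted grading of polynomials then gives the
gradation, and any other one contains it degree by degree, hence equals it
(`existsUnique_gradation`). -/

theorem List.formPerm_map_perm {X : Type*} [DecidableEq X] (f : Equiv.Perm X) (l : List X) :
    (l.map f).formPerm = f * l.formPerm * f⁻¹ := by
  induction l with
  | nil => simp
  | cons x l ih =>
    cases l with
    | nil => simp
    | cons y l =>
      rw [List.map_cons, List.map_cons, List.formPerm_cons_cons, ← List.map_cons, ih,
        List.formPerm_cons_cons, Equiv.swap_apply_apply]
      group

theorem List.minimalPeriod_formPerm {X : Type*} [DecidableEq X] {l : List X} (hl : l.Nodup)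
    {x : X} (hx : x ∈ l) : Function.minimalPeriod l.formPerm x = l.length := by
  have h : l.formPerm.IsCycleOn (l.toFinset : Set X) := by
    simpa using hl.isCycleOn_formPerm
  have key (n : ℕ) : Function.IsPeriodicPt l.formPerm n x ↔ l.length ∣ n := by
    rw [← List.toFinset_card_of_nodup hl, ← h.pow_apply_eq (List.mem_toFinset.2 hx),
      Function.IsPeriodicPt, Function.IsFixedPt, Equiv.Perm.iterate_eq_pow]
  apply Nat.dvd_antisymm
  · exact ((key _).2 dvd_rfl).minimalPeriod_dvd
  · exact (key _).1 (Function.isPeriodicPt_minimalPeriod _ _)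

/-- The product of the star transpositions `(a *)`, for `a` in a list. -/
def starProd (l : List ℕ) : Equiv.Perm ℕ := (l.map fun a => Equiv.swap a 0).prod

@[simp] theorem starProd_nil : starProd [] = 1 := rfl

@[simp] theorem starProd_cons (a : ℕ) (l : List ℕ) :
    starProd (a :: l) = Equiv.swap a 0 * starProd l := by
  simp [starProd]

@[simp] theorem starProd_append (l m : List ℕ) :
    starProd (l ++ m) = starProd l * starProd m := by
  simp [starProd]

theorem jmProd_eq_starProd {k : ℕ} (a : Fin k → ℕ) : jmProd a = starProd (List.ofFn a) := by
  rw [starProd, List.map_ofFn]; rfl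

theorem starProd_apply_of_notMem {l : List ℕ} {x : ℕ} (h0 : x ≠ 0) (hx : x ∉ l) :
    starProd l x = x := by
  induction l with
  | nil => rfl
  | cons a l ih =>
    rw [List.mem_cons, not_or] at hx
    rw [starProd_cons, Equiv.Perm.mul_apply, ih hx.2, Equiv.swap_apply_of_ne_of_ne hx.1 h0]

theorem List.map_swap_eq_self {l : List ℕ} {a b : ℕ} (ha : a ∉ l) (hb : b ∉ l) :
    l.map (Equiv.swap a b) = l := by
  conv_rhs => rw [← List.map_id l]
  refine List.map_congr_left fun x hx => Equiv.swap_apply_of_ne_of_ne ?_ ?_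
  · rintro rfl; exact ha hx
  · rintro rfl; exact hb hx

/-- Conjugating the cycle through `0 :: l` by `swap b 0` replaces 0 by b, which is what one more
star transposition requires. The list is reversed because products act from the right. -/
theorem starProd_reverse {l : List ℕ} (hl : l.Nodup) (h0 : 0 ∉ l) :
    starProd l.reverse = (0 :: l).formPerm := by
  induction l with
  | nil => rfl
  | cons b l ih =>
    rw [List.nodup_cons] at hl
    rw [List.mem_cons, not_or] at h0
    have h := List.formPerm_map_perm (Equiv.swap b 0) (0 :: l)
    rw [List.map_cons, List.map_swap_eq_self hl.1 h0.2, Equiv.swap_apply_right,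
      ← ih hl.2 h0.2] at h
    rw [List.reverse_cons, starProd_append, List.formPerm_cons_cons, h, Equiv.swap_comm 0 b]
    simp [← mul_assoc]

/-- A product of star transpositions starting and ending with the same one is a cycle. -/
theorem starProd_cons_append_self {l : List ℕ} {b : ℕ} (hl : (b :: l).Nodup)
    (h0 : 0 ∉ b :: l) :
    starProd (b :: l ++ [b]) = (b :: l.reverse).formPerm := by
  rw [List.nodup_cons] at hl
  rw [List.mem_cons, not_or] at h0
  -- The outer letters conjugate the cycle on 0 and `l` by `swap b 0`, so b takes the place of 0.
  have h := List.formPerm_map_perm (Equiv.swap b 0) (0 :: l.reverse)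
  rw [List.map_cons, List.map_swap_eq_self (by simpa using hl.1) (by simpa using h0.2),
    Equiv.swap_apply_right, ← starProd_reverse (by simpa using hl.2) (by simpa using h0.2),
    List.reverse_reverse] at h
  rw [h]
  simp [mul_assoc]

/-- If a product of star transpositions fixes `*`, its last letter occurs before. -/
theorem mem_of_starProd_append_fixes {l : List ℕ} {x : ℕ} (hx : x ≠ 0)
    (h : starProd (l ++ [x]) 0 = 0) : x ∈ l := by
  by_contra hxl
  simp only [starProd_append, starProd_cons, starProd_nil, mul_one, Equiv.Perm.mul_apply,
    Equiv.swap_apply_right] at h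
  -- The last letter acts first and sends 0 to x. If x did not recur, nothing would move it back.
  rw [starProd_apply_of_notMem hx hxl] at h
  exact hx h

/-- If a product of distinct star transpositions followed by one more fixes `*`, then the last
one is the first one. -/
theorem eq_of_starProd_append_fixes {l : List ℕ} {b x : ℕ} (hl : (b :: l).Nodup)
    (h0 : b ≠ 0) (h : starProd (b :: l ++ [x]) 0 = 0) : x = b := by
  rw [List.nodup_cons] at hl
  rw [starProd_append, Equiv.Perm.mul_apply] at h
  simp only [starProd_cons (l := []), starProd_nil, mul_one, Equiv.swap_apply_right] at h
  -- The product over `b :: l` sends x to 0 by hypothesis, and b to 0 because b does not occur in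
  -- `l`.
  refine (starProd (b :: l)).injective (h.trans ?_)
  rw [starProd_cons, Equiv.Perm.mul_apply, starProd_apply_of_notMem h0 hl.1,
    Equiv.swap_apply_left]

theorem image_eq_toFinset_ofFn {k : ℕ} (a : Fin k → ℕ) :
    univ.image a = (List.ofFn a).toFinset := by
  ext x; simp [List.mem_ofFn]

/-- The last letter repeats an earlier one, so at most n letters are distinct. With n distinct
letters the first n form a list without repetition, the last letter must equal the first, and the
product is a cycle through all of them. -/
theorem card_image_le_of_jmProd_fixes {n : ℕ} {a : Fin (n + 1) → ℕ} (ha : ∀ i, a i ≠ 0)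
    (h : jmProd a 0 = 0) :
    #(univ.image a) ≤ n ∧ (#(univ.image a) = n → ∀ x ∈ univ.image a,
      Function.minimalPeriod (jmProd a) x = n) := by
  obtain ⟨l, x, hlx⟩ : ∃ (l : List ℕ) (x : ℕ), List.ofFn a = l ++ [x] :=
    ⟨_, _, List.ofFn_succ_last⟩
  have hlen : l.length = n := by
    have := congrArg List.length hlx
    simpa using this.symm
  have h0 : 0 ∉ l ++ [x] := by
    rw [← hlx, List.mem_ofFn]
    rintro ⟨i, hi⟩
    exact ha i hi
  rw [jmProd_eq_starProd, image_eq_toFinset_ofFn]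
  rw [jmProd_eq_starProd] at h
  rw [hlx] at h ⊢
  have hx0 : x ≠ 0 := by rintro rfl; simp at h0
  have hxl := mem_of_starProd_append_fixes hx0 h
  have himg : (l ++ [x]).toFinset = l.toFinset := by
    ext y; simp; rintro rfl; exact hxl
  rw [himg, ← hlen]
  refine ⟨l.toFinset_card_le, fun hc y hy => ?_⟩
  have hl : l.Nodup := by
    rw [← Multiset.coe_nodup, ← Multiset.toFinset_card_eq_card_iff_nodup]
    exact hc
  cases l with
  | nil => simp at hxl
  | cons b l =>
    have hb : b ≠ 0 := by rintro rfl; simp at h0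
    obtain rfl := eq_of_starProd_append_fixes hl hb h
    rw [starProd_cons_append_self hl (fun hm => h0 (by simp at hm ⊢; tauto)),
      List.minimalPeriod_formPerm (by simpa using hl) (by simpa using hy)]
    simp

/-- The tuple `s + 1, …, s + n, s + 1`. -/
def shiftTuple (s n : ℕ) (i : Fin (n + 1)) : ℕ := if (i : ℕ) = n then s + 1 else s + 1 + i

theorem image_shiftTuple {s n : ℕ} (hn : 1 ≤ n) :
    univ.image (shiftTuple s n) = Ioc s (s + n) := by
  ext x
  simp only [mem_image, mem_univ, true_and, mem_Ioc, shiftTuple]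
  constructor
  · rintro ⟨i, rfl⟩
    have := i.2
    split_ifs <;> omega
  · rintro ⟨h1, h2⟩
    refine ⟨⟨x - (s + 1), by omega⟩, ?_⟩
    simp only
    split_ifs <;> omega

theorem jmProd_shiftTuple {s n : ℕ} (hn : 1 ≤ n) : jmProd (shiftTuple s n) 0 = 0 := by
  obtain ⟨m, rfl⟩ : ∃ m, n = m + 1 := ⟨n - 1, by omega⟩
  have hofn : List.ofFn (shiftTuple s (m + 1)) =
      (s + 1) :: (List.ofFn fun i : Fin m => s + 2 + i) ++ [s + 1] := by
    rw [List.ofFn_succ_last, List.ofFn_succ]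
    simp [shiftTuple]
    funext i
    have := i.2
    rw [if_neg (by omega)]
    omega
  rw [jmProd_eq_starProd, hofn, starProd_cons_append_self]
  · apply List.formPerm_apply_of_notMem
    simp [List.mem_ofFn]
  · rw [List.nodup_cons, List.nodup_ofFn]
    refine ⟨?_, fun i j h => ?_⟩
    · simp [List.mem_ofFn]; omega
    · simp only at h; ext; omega
  · simp [List.mem_ofFn]

/-! ### Cycle types of products of partial permutations -/

theorem Function.minimalPeriod_congr {X : Type*} {f g : X → X} {s : Set X}
    (hfg : Set.EqOn f g s) (hg : Set.MapsTo g s s) {x : X} (hx : x ∈ s) :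
    Function.minimalPeriod f x = Function.minimalPeriod g x := by
  have key (n : ℕ) : f^[n] x = g^[n] x ∧ g^[n] x ∈ s := by
    induction n with
    | zero => exact ⟨rfl, hx⟩
    | succ n ih =>
      rw [Function.iterate_succ_apply', Function.iterate_succ_apply', ih.1, hfg ih.2]
      exact ⟨rfl, hg ih.2⟩
  rw [Function.minimalPeriod_eq_minimalPeriod_iff]
  intro n
  rw [Function.IsPeriodicPt, Function.IsFixedPt, (key n).1]
  rfl

namespace PartialPerm

variable {q : ℕ}

/-- The number of points of the support that lie on cycles of length `j`. -/
noncomputable def cycleCount (α : PartialPerm q) (j : ℕ) : ℕ :=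
  #{x ∈ α.support | Function.minimalPeriod α.perm x = j}

theorem card_mul_le (α β : PartialPerm q) :
    #(α * β).support ≤ #α.support + #β.support := card_union_le _ _

/-- Additivity of cardinalities means that the supports are disjoint. On each of them the product
acts as the corresponding factor. -/
theorem cycleCount_mul {α β : PartialPerm q}
    (h : #(α * β).support = #α.support + #β.support) :
    (α * β).cycleCount = α.cycleCount + β.cycleCount := by
  have hd : Disjoint α.support β.support := card_union_eq_card_add_card.1 h
  funext j
  rw [Pi.add_apply, cycleCount, mul_support, filter_union, card_union_of_disjoint
    (disjoint_filter_filter hd)]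
  congr 1
  · refine congrArg card (filter_congr fun x hx => ?_)
    rw [Function.minimalPeriod_congr (g := α.perm) (s := α.support) ?_ ?_ hx]
    · intro y hy
      rw [mul_perm, Equiv.Perm.mul_apply, β.perm_eq y (disjoint_left.1 hd hy)]
    · exact fun y hy => (α.perm_mem_iff y).2 hy
  · refine congrArg card (filter_congr fun x hx => ?_)
    rw [Function.minimalPeriod_congr (g := β.perm) (s := β.support) ?_ ?_ hx]
    · intro y hy
      rw [mul_perm, Equiv.Perm.mul_apply, α.perm_eq]
      exact disjoint_right.1 hd ((β.perm_mem_iff y).2 hy)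
    · exact fun y hy => (β.perm_mem_iff y).2 hy

end PartialPerm

/-! ### Leading terms in `𝔓` -/

/-- The component in `ℂ(S_q)` of an element of `𝔓`. -/
noncomputable def jmComponent (q : ℕ) : jmAlgebra →ₐ[ℂ] PartialPermAlgebra q :=
  (Pi.evalAlgHom ℂ PartialPermAlgebra q).comp (PartialPermAlgebraInfty.val.comp jmAlgebra.val)

theorem jmComponent_injective {x y : jmAlgebra} (h : ∀ q, jmComponent q x = jmComponent q y) :
    x = y :=
  Subtype.ext (Subtype.ext (funext h))

theorem jmComponent_jmMoment (q k : ℕ) : jmComponent q (jmMoment k) = jmMomentFin q k := rfl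

/-- All partial permutations occurring in `x` have supports of cardinality at most `N`. -/
def DegLE (x : jmAlgebra) (N : ℕ) : Prop :=
  ∀ (q : ℕ) (α : PartialPerm q), (jmComponent q x).coeff α ≠ 0 → #α.support ≤ N

open scoped ComplexOrder in
/-- The part of `x` in degree `N` (the cardinality of the support) is the leading one, it
consists of partial permutations with `c j` points on cycles of length `j`, it has non-negative
coefficients, and it has nonzero terms on all sufficiently long intervals. -/
structure HasLead (x : jmAlgebra) (N : ℕ) (c : ℕ → ℕ) : Prop where
  degLE : DegLE x N
  nonneg : ∀ (q : ℕ) (α : PartialPerm q), #α.support = N → 0 ≤ (jmComponent q x).coeff α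
  cycleCount_eq : ∀ (q : ℕ) (α : PartialPerm q), #α.support = N →
    (jmComponent q x).coeff α ≠ 0 → α.cycleCount = c
  exists_coeff_ne : ∀ q s : ℕ, s + N ≤ q → ∃ α : PartialPerm q, α.support = Ioc s (s + N) ∧
    (jmComponent q x).coeff α ≠ 0

theorem exists_of_coeff_mul_ne {R G : Type*} [Semiring R] [Mul G] {f g : MonoidAlgebra R G}
    {α : G} (h : (f * g).coeff α ≠ 0) :
    ∃ β γ, f.coeff β ≠ 0 ∧ g.coeff γ ≠ 0 ∧ β * γ = α := by
  classical
  rw [MonoidAlgebra.coeff_mul] at h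
  obtain ⟨β, hβ, h⟩ := exists_ne_zero_of_sum_ne_zero h
  obtain ⟨γ, hγ, h⟩ := exists_ne_zero_of_sum_ne_zero h
  refine ⟨β, γ, Finsupp.mem_support_iff.1 hβ, Finsupp.mem_support_iff.1 hγ, ?_⟩
  by_contra hne
  simp [hne] at h

theorem DegLE.mono {x : jmAlgebra} {N N' : ℕ} (h : DegLE x N) (hN : N ≤ N') : DegLE x N' :=
  fun q α hα => (h q α hα).trans hN

theorem degLE_zero (N : ℕ) : DegLE 0 N := by
  intro q α h
  simp at h

theorem DegLE.add {x y : jmAlgebra} {N : ℕ} (hx : DegLE x N) (hy : DegLE y N) :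
    DegLE (x + y) N := by
  intro q α h
  by_contra hN
  rw [map_add, MonoidAlgebra.coeff_add, Finsupp.add_apply,
    not_not.1 (mt (hx q α) hN), not_not.1 (mt (hy q α) hN), add_zero] at h
  exact h rfl

theorem DegLE.smul {x : jmAlgebra} {N : ℕ} (hx : DegLE x N) (c : ℤ) : DegLE (c • x) N := by
  intro q α h
  by_contra hN
  rw [map_zsmul, MonoidAlgebra.coeff_smul, Finsupp.smul_apply,
    not_not.1 (mt (hx q α) hN), smul_zero] at h
  exact h rfl

theorem DegLE.sum {ι : Type*} {s : Finset ι} {f : ι → jmAlgebra} {N : ℕ}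
    (h : ∀ i ∈ s, DegLE (f i) N) : DegLE (∑ i ∈ s, f i) N :=
  sum_induction f (DegLE · N) (fun _ _ => DegLE.add) (degLE_zero N) h

theorem DegLE.mul {x y : jmAlgebra} {N N' : ℕ} (hx : DegLE x N) (hy : DegLE y N') :
    DegLE (x * y) (N + N') := by
  intro q α h
  rw [map_mul] at h
  obtain ⟨β, γ, hβ, hγ, rfl⟩ := exists_of_coeff_mul_ne h
  exact (β.card_mul_le γ).trans (Nat.add_le_add (hx q β hβ) (hy q γ hγ))

theorem coeff_one_ne {q : ℕ} {α : PartialPerm q}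
    (h : (jmComponent q 1).coeff α ≠ 0) : α = 1 := by
  classical
  rw [map_one, MonoidAlgebra.one_def, MonoidAlgebra.coeff_single, Finsupp.single_apply] at h
  by_contra hne
  exact h (if_neg (Ne.symm hne))

open scoped ComplexOrder in
theorem hasLead_one : HasLead 1 0 0 where
  degLE q α h := by rw [coeff_one_ne h]; rfl
  nonneg q α _ := by
    classical
    rw [map_one, MonoidAlgebra.one_def, MonoidAlgebra.coeff_single, Finsupp.single_apply]
    split_ifs
    · exact zero_le_one
    · exact le_rfl
  cycleCount_eq q α _ h := by
    rw [coeff_one_ne h]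
    funext j
    simp [PartialPerm.cycleCount]
  exists_coeff_ne q s _ := ⟨1, by simp, by
    rw [map_one (jmComponent q), MonoidAlgebra.one_def, MonoidAlgebra.coeff_single]; simp⟩

theorem DegLE.prod {ι : Type*} {s : Finset ι} {f : ι → jmAlgebra} {N : ι → ℕ}
    (h : ∀ i ∈ s, DegLE (f i) (N i)) : DegLE (∏ i ∈ s, f i) (∑ i ∈ s, N i) := by
  classical
  induction s using Finset.induction_on with
  | empty => simpa using hasLead_one.degLE
  | insert i s hi ih =>
    rw [prod_insert hi, sum_insert hi]
    exact (h i (mem_insert_self i s)).mul (ih fun j hj => h j (mem_insert_of_mem hj))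

-- Since the support of a product has at most the sum of the two cardinalities, degree N + N' is
-- reached only by leading terms of both factors, with disjoint supports. The coefficients there are
-- sums of products of non-negative numbers, so nothing cancels.
open scoped ComplexOrder in
theorem HasLead.mul {x y : jmAlgebra} {N N' : ℕ} {c c' : ℕ → ℕ} (hx : HasLead x N c)
    (hy : HasLead y N' c') : HasLead (x * y) (N + N') (c + c') := by
  classical
  have card_eq {q : ℕ} {β γ : PartialPerm q} (hβ : (jmComponent q x).coeff β ≠ 0)
      (hγ : (jmComponent q y).coeff γ ≠ 0) (h : #(β * γ).support = N + N') :
      #β.support = N ∧ #γ.support = N' := by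
    have := β.card_mul_le γ
    have := hx.degLE q β hβ
    have := hy.degLE q γ hγ
    omega
  have term_nonneg {q : ℕ} {α : PartialPerm q} (h : #α.support = N + N')
      {β : PartialPerm q} (hβ : β ∈ (jmComponent q x).coeff.support)
      {γ : PartialPerm q} (hγ : γ ∈ (jmComponent q y).coeff.support) :
      0 ≤ if β * γ = α then (jmComponent q x).coeff β * (jmComponent q y).coeff γ else 0 := by
    split_ifs with he
    · subst he
      obtain ⟨h1, h2⟩ := card_eq (Finsupp.mem_support_iff.1 hβ) (Finsupp.mem_support_iff.1 hγ) h
      exact mul_nonneg (hx.nonneg q β h1) (hy.nonneg q γ h2)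
    · exact le_rfl
  refine ⟨hx.degLE.mul hy.degLE, fun q α h => ?_, fun q α h hα => ?_, fun q s hs => ?_⟩
  · rw [map_mul, MonoidAlgebra.coeff_mul]
    exact sum_nonneg fun β hβ => sum_nonneg fun γ hγ => term_nonneg h hβ hγ
  · rw [map_mul] at hα
    obtain ⟨β, γ, hβ, hγ, rfl⟩ := exists_of_coeff_mul_ne hα
    obtain ⟨h1, h2⟩ := card_eq hβ hγ h
    rw [PartialPerm.cycleCount_mul (by rw [h, h1, h2]), hx.cycleCount_eq q β h1 hβ,
      hy.cycleCount_eq q γ h2 hγ]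
  · obtain ⟨β, hβs, hβ⟩ := hx.exists_coeff_ne q s (by omega)
    obtain ⟨γ, hγs, hγ⟩ := hy.exists_coeff_ne q (s + N) (by omega)
    have hsupp : (β * γ).support = Ioc s (s + (N + N')) := by
      rw [PartialPerm.mul_support, hβs, hγs, Ioc_union_Ioc_eq_Ioc (by omega) (by omega),
        add_assoc]
    have hcard : #(β * γ).support = N + N' := by rw [hsupp]; simp
    refine ⟨β * γ, hsupp, ?_⟩
    rw [map_mul (jmComponent q), MonoidAlgebra.coeff_mul]
    refine (sum_pos' (fun β' hβ' => sum_nonneg fun γ' hγ' => term_nonneg hcard hβ' hγ')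
      ⟨β, Finsupp.mem_support_iff.2 hβ, sum_pos' (fun γ' hγ' => term_nonneg hcard
        (Finsupp.mem_support_iff.2 hβ) hγ') ⟨γ, Finsupp.mem_support_iff.2 hγ, ?_⟩⟩).ne'
    refine lt_of_le_of_ne (term_nonneg hcard (Finsupp.mem_support_iff.2 hβ)
      (Finsupp.mem_support_iff.2 hγ)) ?_
    rw [if_pos rfl]
    exact (mul_ne_zero hβ hγ).symm

theorem HasLead.pow {x : jmAlgebra} {N : ℕ} {c : ℕ → ℕ} (hx : HasLead x N c) (e : ℕ) :
    HasLead (x ^ e) (e * N) (e • c) := by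
  induction e with
  | zero => simpa using hasLead_one
  | succ e ih =>
    rw [pow_succ, add_mul, one_mul, add_smul, one_smul]
    exact ih.mul hx

theorem HasLead.prod {ι : Type*} {s : Finset ι} {f : ι → jmAlgebra} {N : ι → ℕ}
    {c : ι → ℕ → ℕ} (h : ∀ i ∈ s, HasLead (f i) (N i) (c i)) :
    HasLead (∏ i ∈ s, f i) (∑ i ∈ s, N i) (∑ i ∈ s, c i) := by
  classical
  induction s using Finset.induction_on with
  | empty => simpa using hasLead_one
  | insert i s hi ih =>
    rw [prod_insert hi, sum_insert hi, sum_insert hi]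
    exact (h i (mem_insert_self i s)).mul (ih fun j hj => h j (mem_insert_of_mem hj))

theorem HasLead.add_degLE {x y : jmAlgebra} {n : ℕ} {c : ℕ → ℕ} (hx : HasLead x (n + 1) c)
    (hy : DegLE y n) : HasLead (x + y) (n + 1) c := by
  have key {q : ℕ} {α : PartialPerm q} (h : #α.support = n + 1) :
      (jmComponent q (x + y)).coeff α = (jmComponent q x).coeff α := by
    rw [map_add, MonoidAlgebra.coeff_add, Finsupp.add_apply,
      not_not.1 (mt (hy q α) (by omega)), add_zero]
  refine ⟨hx.degLE.add (hy.mono n.le_succ), fun q α h => ?_, fun q α h hα => ?_, fun q s hs => ?_⟩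
  · rw [key h]
    exact hx.nonneg q α h
  · rw [key h] at hα
    exact hx.cycleCount_eq q α h hα
  · obtain ⟨α, hs, hα⟩ := hx.exists_coeff_ne q s hs
    exact ⟨α, hs, by rwa [key (by rw [hs]; simp)]⟩

/-! ### The moments -/

theorem coeff_jmTerm_ne {q k : ℕ} {a : Fin k → ℕ} {α : PartialPerm q}
    (h : (jmTerm q a).coeff α ≠ 0) :
    α.support = univ.image a ∧ α.perm = jmProd a ∧ jmProd a 0 = 0 := by
  classical
  unfold jmTerm at h
  split_ifs at h with h'
  · rw [MonoidAlgebra.coeff_single, Finsupp.single_apply] at h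
    split_ifs at h with he
    · subst he
      exact ⟨rfl, rfl, h'.2⟩
    · exact absurd rfl h
  · exact absurd rfl h

open scoped ComplexOrder in
theorem coeff_jmTerm_nonneg {q k : ℕ} (a : Fin k → ℕ) (α : PartialPerm q) :
    0 ≤ (jmTerm q a).coeff α := by
  classical
  unfold jmTerm
  split_ifs
  · rw [MonoidAlgebra.coeff_single, Finsupp.single_apply]
    split_ifs <;> simp
  · exact le_rfl

theorem coeff_jmMoment (q k : ℕ) (α : PartialPerm q) :
    (jmComponent q (jmMoment k)).coeff α =
      ∑ a ∈ Fintype.piFinset fun _ : Fin k => Icc 1 q, (jmTerm q a).coeff α := by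
  rw [jmComponent_jmMoment, jmMomentFin, MonoidAlgebra.coeff_sum, Finsupp.finsetSum_apply]

theorem coeff_jmMoment_ne {q n : ℕ} {α : PartialPerm q}
    (h : (jmComponent q (jmMoment (n + 1))).coeff α ≠ 0) :
    #α.support ≤ n ∧ (#α.support = n → ∀ x ∈ α.support,
      Function.minimalPeriod α.perm x = n) := by
  rw [coeff_jmMoment] at h
  obtain ⟨a, ha, h⟩ := exists_ne_zero_of_sum_ne_zero h
  obtain ⟨h1, h2, h3⟩ := coeff_jmTerm_ne h
  rw [h1, h2]
  refine card_image_le_of_jmProd_fixes (fun i hi => ?_) h3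
  have := Fintype.mem_piFinset.1 ha i
  simp [hi] at this

theorem degLE_jmMoment (n : ℕ) : DegLE (jmMoment (n + 1)) n :=
  fun _ _ h => (coeff_jmMoment_ne h).1

-- The top terms are n-cycles on their whole support, with the tuple `shiftTuple s n` as a witness
-- on each interval. For n = 1 they are fixed points that belong to the support, which `cycleCount`
-- still records.
open scoped ComplexOrder in
theorem hasLead_jmMoment {n : ℕ} (hn : 1 ≤ n) :
    HasLead (jmMoment (n + 1)) n (Pi.single n n) where
  degLE := degLE_jmMoment n
  nonneg q α _ := by
    rw [coeff_jmMoment]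
    exact sum_nonneg fun a _ => coeff_jmTerm_nonneg a α
  cycleCount_eq q α h hα := by
    have hp := (coeff_jmMoment_ne hα).2 h
    funext j
    rw [PartialPerm.cycleCount, filter_congr fun x hx => by rw [hp x hx], filter_const]
    rcases eq_or_ne n j with rfl | hj
    · simp [h]
    · simp [hj, Ne.symm hj]
  exists_coeff_ne q s hs := by
    have hsub : univ.image (shiftTuple s n) ⊆ Icc 1 q := by
      rw [image_shiftTuple hn]
      intro x hx
      simp only [mem_Ioc, mem_Icc] at hx ⊢
      omega
    have h0 := jmProd_shiftTuple (s := s) hn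
    refine ⟨⟨univ.image (shiftTuple s n), jmProd (shiftTuple s n), hsub,
      jmProd_eq_self _ h0⟩, image_shiftTuple hn, ?_⟩
    rw [coeff_jmMoment]
    refine (sum_pos' (fun a _ => coeff_jmTerm_nonneg a _) ⟨shiftTuple s n, ?_, ?_⟩).ne'
    · exact Fintype.mem_piFinset.2 fun i => hsub (mem_image_of_mem _ (mem_univ i))
    · rw [jmTerm, dif_pos ⟨hsub, h0⟩, MonoidAlgebra.coeff_single, Finsupp.single_eq_same]
      exact one_pos

theorem jmMoment_zero : jmMoment 0 = 1 := by
  refine jmComponent_injective fun q => ?_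
  rw [jmComponent_jmMoment, map_one, jmMomentFin]
  have : (Fintype.piFinset fun _ : Fin 0 => Icc 1 q) = {Fin.elim0} := by
    
    exact eq_singleton_iff_unique_mem.2 ⟨Fintype.mem_piFinset.2 fun i => i.elim0,
      fun a _ => Subsingleton.elim a _⟩
  rw [this, sum_singleton, jmTerm, dif_pos (by simp [jmProd]), MonoidAlgebra.one_def]
  rfl

/-- A single star transposition never fixes `*`. -/
theorem jmMoment_one : jmMoment 1 = 0 := by
  refine jmComponent_injective fun q => ?_
  rw [jmComponent_jmMoment, map_zero, jmMomentFin]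
  refine sum_eq_zero fun a ha => ?_
  rw [jmTerm, dif_neg]
  rintro ⟨-, h⟩
  have ha := Fintype.mem_piFinset.1 ha 0
  simp [jmProd] at h
  simp [h] at ha

/-! ### Algebraic independence -/

/-- Elements of `𝔓` led by `(k - 1)`-cycles, one for each `k ≥ 2`, are algebraically independent:
the leading terms of their monomials have distinct cycle types. -/
theorem algebraicIndependent_of_hasLead {y : {k : ℕ // 2 ≤ k} → jmAlgebra}
    (hy : ∀ k, HasLead (y k) (k - 1) (Pi.single ((k : ℕ) - 1) ((k : ℕ) - 1))) :
    AlgebraicIndependent ℂ y := by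
  set N : ({k : ℕ // 2 ≤ k} →₀ ℕ) → ℕ := fun m => ∑ k ∈ m.support, m k * ((k : ℕ) - 1) with hN
  set c : ({k : ℕ // 2 ≤ k} →₀ ℕ) → ℕ → ℕ := fun m =>
    ∑ k ∈ m.support, m k • Pi.single ((k : ℕ) - 1) ((k : ℕ) - 1) with hc
  have hlead (m : {k : ℕ // 2 ≤ k} →₀ ℕ) : HasLead (∏ k ∈ m.support, y k ^ m k) (N m) (c m) :=
    HasLead.prod fun k _ => (hy k).pow (m k)
  -- Distinct k have distinct cycle lengths k - 1, so the cycle type recovers each exponent; k ≥ 2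
  -- makes the factor k - 1 nonzero.
  have hcapp (m : {k : ℕ // 2 ≤ k} →₀ ℕ) (k : {k : ℕ // 2 ≤ k}) :
      c m ((k : ℕ) - 1) = m k * ((k : ℕ) - 1) := by
    have hk := k.2
    simp only [hc, Finset.sum_apply, Pi.smul_apply, smul_eq_mul]
    rw [sum_eq_single k]
    · simp
    · intro l _ hl
      have hl2 := l.2
      rw [Pi.single_eq_of_ne, mul_zero]
      intro h
      exact hl (Subtype.ext (by omega))
    · intro hk
      rw [Finsupp.notMem_support_iff.1 hk, zero_mul]
  have hcinj : Function.Injective c := by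
    intro m m' h
    ext k
    have hk := k.2
    have h' := congrFun h ((k : ℕ) - 1)
    rw [hcapp, hcapp] at h'
    exact Nat.eq_of_mul_eq_mul_right (by omega) h'
  rw [algebraicIndependent_iff]
  intro p hp
  by_contra hp0
  -- Among the monomials of a relation, take one of maximal leading degree and a leading term α of
  -- it. Another monomial containing α would have the same degree, so α would be a leading term of
  -- it too, and the cycle type of α would identify the two exponents.
  obtain ⟨m, hm, hmax⟩ := exists_max_image p.support N
    (MvPolynomial.support_nonempty.2 hp0)
  obtain ⟨α, hαs, hα⟩ := (hlead m).exists_coeff_ne (N m) 0 (by omega)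
  have hcard : #α.support = N m := by rw [hαs]; simp
  have h0 : (jmComponent (N m) (MvPolynomial.aeval y p)).coeff α =
      p.coeff m * (jmComponent (N m) (∏ k ∈ m.support, y k ^ m k)).coeff α := by
    rw [MvPolynomial.aeval_def, MvPolynomial.eval₂_eq, map_sum, MonoidAlgebra.coeff_sum,
      Finsupp.finsetSum_apply, sum_eq_single_of_mem m hm]
    · rw [← Algebra.smul_def, map_smul, MonoidAlgebra.coeff_smul, Finsupp.smul_apply, smul_eq_mul]
    · intro m' hm' hne
      rw [← Algebra.smul_def, map_smul, MonoidAlgebra.coeff_smul, Finsupp.smul_apply, smul_eq_mul]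
      by_contra h
      have h := right_ne_zero_of_mul h
      have hle := (hlead m').degLE _ _ h
      have hNm : #α.support = N m' := le_antisymm hle (by rw [hcard]; exact hmax m' hm')
      exact hne (hcinj (((hlead m').cycleCount_eq _ α hNm h).symm.trans
        ((hlead m).cycleCount_eq _ α hcard hα)))
  rw [hp, map_zero] at h0
  exact mul_ne_zero (MvPolynomial.mem_support_iff.1 hm) hα h0.symm

/-! ### The free cumulants -/

theorem finpartition_parts_eq_singleton {n : ℕ}
    {ρ : Finpartition (univ : Finset (Fin (n + 1)))} (h : #ρ.parts ≤ 1) : ρ.parts = {univ} := by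
  obtain ⟨B, hB, -⟩ := ρ.exists_mem (mem_univ 0)
  have h1 : ρ.parts = {B} := by
    refine eq_singleton_iff_unique_mem.2 ⟨hB, fun C hC => card_le_one.1 h C hC B hB⟩
  have h2 := ρ.sup_parts
  rw [h1, sup_singleton] at h2
  rw [h1, ← h2]; rfl

theorem connected_indiscrete {n : ℕ} {ρ : Finpartition (univ : Finset (Fin n))}
    (h : ρ.parts = {univ}) (i j : Fin n) : Connected ρ i j :=
  ⟨univ, by simp [h], mem_univ i, mem_univ j⟩

theorem moebNC_kreweras_indiscrete {n : ℕ} {ρ : Finpartition (univ : Finset (Fin n))}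
    (h : ρ.parts = {univ}) : moebNC (kreweras ρ) = 1 := by
  refine prod_eq_one fun B hB => ?_
  have hcard : #B - 1 = 0 := by
    have : #B ≤ 1 := by
      refine card_le_one.2 fun i hi j hj => ?_
      -- Testing the complement relation on the pair i, j itself yields j ≤ i ↔ i ≤ j. Hence the
      -- blocks are singletons, each with factor c_0 = 1.
      have hc := (connected_kreweras_iff ρ i j).1 ⟨B, hB, hi, hj⟩ i j
        (connected_indiscrete h i j)
      simp only [le_refl, iff_true, true_iff] at hc
      exact le_antisymm (by grind) (by grind)
    omega
  simp [hcard]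

/-- Each block B contributes degree at most |B| - 1, so the total is at most n minus the number of
blocks. -/
theorem degLE_prod_jmMoment {n : ℕ} (ρ : Finpartition (univ : Finset (Fin n)))
    (h : 1 < #ρ.parts) : DegLE (∏ B ∈ ρ.parts, jmMoment #B) (n - 2) := by
  have hpos (B) (hB : B ∈ ρ.parts) : #B - 1 + 1 = #B :=
    Nat.sub_add_cancel (card_pos.2 (ρ.nonempty_of_mem_parts hB))
  have hd : DegLE (∏ B ∈ ρ.parts, jmMoment #B) (∑ B ∈ ρ.parts, (#B - 1)) := by
    refine DegLE.prod fun B hB => ?_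
    conv_lhs => rw [← hpos B hB]
    exact degLE_jmMoment _
  refine hd.mono ?_
  have hsum : ∑ B ∈ ρ.parts, (#B - 1) + #ρ.parts = n := by
    rw [card_eq_sum_ones, ← sum_add_distrib, sum_congr rfl hpos, ρ.sum_card_parts, card_fin]
  omega

/-- The one-block partition has Möbius coefficient 1. All others have at least two blocks, which
puts them below the leading degree n of M_{n+1} when n ≥ 1. -/
theorem exists_jmCumulant_eq (n : ℕ) :
    ∃ x, jmCumulant (n + 1) = jmMoment (n + 1) + x ∧ DegLE x (n - 1) := by
  classical
  let τ : Finpartition (univ : Finset (Fin (n + 1))) :=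
    Finpartition.indiscrete (by simpa using univ_nonempty.ne_empty)
  have hτ : τ.parts = {univ} := rfl
  have hmem : τ ∈ (univ.filter fun ρ => NonCrossing ρ :
      Finset (Finpartition (univ : Finset (Fin (n + 1))))) :=
    mem_filter.2 ⟨mem_univ _, fun a b _ _ _ _ _ _ _ => connected_indiscrete hτ a b⟩
  refine ⟨∑ ρ ∈ (univ.filter fun ρ => NonCrossing ρ).erase τ,
    moebNC (kreweras ρ) • ∏ B ∈ ρ.parts, jmMoment #B, ?_, ?_⟩
  · rw [jmCumulant, freeCumulant]
    convert (add_sum_erase _ _ hmem).symm using 2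
    · rw [moebNC_kreweras_indiscrete hτ, one_smul, hτ, prod_singleton, card_univ,
        Fintype.card_fin]
  · refine DegLE.sum fun ρ hρ => DegLE.smul ?_ _
    refine degLE_prod_jmMoment ρ ?_
    by_contra h
    refine ne_of_mem_erase hρ (Finpartition.ext ?_)
    rw [finpartition_parts_eq_singleton (not_lt.1 h), hτ]

theorem hasLead_jmMoment_subtype (k : {k : ℕ // 2 ≤ k}) :
    HasLead (jmMoment k) (k - 1) (Pi.single ((k : ℕ) - 1) ((k : ℕ) - 1)) := by
  obtain ⟨k, hk⟩ := k
  obtain ⟨n, rfl⟩ : ∃ n, k = n + 2 := ⟨k - 2, by omega⟩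
  exact hasLead_jmMoment (n := n + 1) (by omega)

theorem hasLead_jmCumulant_subtype (k : {k : ℕ // 2 ≤ k}) :
    HasLead (jmCumulant k) (k - 1) (Pi.single ((k : ℕ) - 1) ((k : ℕ) - 1)) := by
  obtain ⟨k, hk⟩ := k
  obtain ⟨n, rfl⟩ : ∃ n, k = n + 2 := ⟨k - 2, by omega⟩
  obtain ⟨x, hx, hd⟩ := exists_jmCumulant_eq (n + 1)
  rw [hx]
  exact (hasLead_jmMoment (n := n + 1) (by omega)).add_degLE hd

/-! ### The gradation -/

/-- The sum of the other `A j` is a common complement of `A i` and `B i`. In a modular lattice,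
comparable elements with a common complement coincide. -/
theorem DirectSum.IsInternal.eq_of_le {R M ι : Type*} [Ring R] [AddCommGroup M] [Module R M]
    [DecidableEq ι] {A B : ι → Submodule R M} (hA : IsInternal A) (hB : IsInternal B)
    (h : ∀ i, A i ≤ B i) : A = B := by
  rw [isInternal_submodule_iff_iSupIndep_and_iSup_eq_top] at hA hB
  funext i
  refine eq_of_le_of_inf_le_of_le_sup (z := ⨆ (j) (_ : j ≠ i), A j) (h i) ?_ ?_
  · refine le_trans ?_ bot_le
    rw [← (hB.1 i).eq_bot]
    exact inf_le_inf_left _ (iSup₂_mono fun j _ => h j)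
  · refine le_top.trans ?_
    rw [← hA.2, iSup_le_iff]
    intro j
    rcases eq_or_ne j i with rfl | hj
    · exact le_sup_left
    · exact le_sup_of_le_right (le_iSup₂_of_le j hj le_rfl)

theorem DirectSum.IsInternal.map_linearEquiv {R M M' ι : Type*} [Ring R] [AddCommGroup M]
    [Module R M] [AddCommGroup M'] [Module R M'] [DecidableEq ι] {A : ι → Submodule R M}
    (hA : IsInternal A) (e : M ≃ₗ[R] M') : IsInternal fun i => (A i).map (e : M →ₗ[R] M') := by
  rw [isInternal_submodule_iff_iSupIndep_and_iSup_eq_top] at hA ⊢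
  refine ⟨hA.1.map_orderIso (Submodule.orderIsoMapComap e), ?_⟩
  rw [← Submodule.map_iSup, hA.2, Submodule.map_top, LinearEquiv.range]

theorem SetLike.GradedMonoid.map_algEquiv {K A B : Type*} [CommRing K] [CommRing A] [CommRing B]
    [Algebra K A] [Algebra K B] {𝒜 : ℕ → Submodule K A} (h : SetLike.GradedMonoid 𝒜)
    (e : A ≃ₐ[K] B) :
    SetLike.GradedMonoid fun d => (𝒜 d).map (e.toLinearEquiv : A →ₗ[K] B) where
  one_mem := ⟨1, h.one_mem, map_one e⟩
  mul_mem := by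
    rintro i j _ _ ⟨a, ha, rfl⟩ ⟨b, hb, rfl⟩
    exact ⟨a * b, h.mul_mem ha hb, map_mul e a b⟩

theorem MvPolynomial.isInternal_weightedHomogeneousSubmodule (K : Type*) [CommRing K] {ι : Type*}
    (w : ι → ℕ) : DirectSum.IsInternal (weightedHomogeneousSubmodule K w) :=
  let := weightedDecomposition K w
  DirectSum.Decomposition.isInternal _

theorem MvPolynomial.aeval_mem_of_isWeightedHomogeneous {K V ι : Type*} [CommRing K] [CommRing V]
    [Algebra K V] {x : ι → V} {w : ι → ℕ} (ℬ : ℕ → Submodule K V) [SetLike.GradedMonoid ℬ]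
    (hmem : ∀ i, x i ∈ ℬ (w i)) {d : ℕ} {p : MvPolynomial ι K}
    (hp : IsWeightedHomogeneous w p d) : aeval x p ∈ ℬ d := by
  rw [aeval_def, eval₂_eq]
  refine sum_mem fun m hm => ?_
  have hd : Finsupp.weight w m = d := hp (mem_support_iff.1 hm)
  rw [← Algebra.smul_def, ← hd, Finsupp.weight_apply, Finsupp.sum]
  exact Submodule.smul_mem _ _ (SetLike.prod_mem_graded _ _ _ fun i _ =>
    SetLike.pow_mem_graded _ (hmem i))

/-- If an algebra is freely generated by `x`, there is exactly one gradation in which `x i` has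
degree `w i`. -/
theorem existsUnique_gradation {K V ι : Type*} [CommRing K] [CommRing V] [Algebra K V]
    {x : ι → V} (hx : AlgebraicIndependent K x) (hgen : Algebra.adjoin K (Set.range x) = ⊤)
    (w : ι → ℕ) : ∃! 𝒜 : ℕ → Submodule K V,
      SetLike.GradedMonoid 𝒜 ∧ DirectSum.IsInternal 𝒜 ∧ ∀ i, x i ∈ 𝒜 (w i) := by
  have hsurj : Function.Surjective (MvPolynomial.aeval (R := K) x) := by
    rw [← AlgHom.range_eq_top, ← Algebra.adjoin_range_eq_range_aeval, hgen]
  obtain ⟨e, he⟩ : ∃ e : MvPolynomial ι K ≃ₐ[K] V, ∀ p, e p = MvPolynomial.aeval x p :=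
    ⟨AlgEquiv.ofBijective (MvPolynomial.aeval x) ⟨hx, hsurj⟩, fun _ => rfl⟩
  have hV := (MvPolynomial.isInternal_weightedHomogeneousSubmodule K w).map_linearEquiv
    e.toLinearEquiv
  have hgV := SetLike.GradedMonoid.map_algEquiv
    (MvPolynomial.WeightedHomogeneousSubmodule.gradedMonoid (R := K) (w := w)) e
  refine ⟨_, ⟨hgV, hV, fun i => ?_⟩, ?_⟩
  · exact ⟨MvPolynomial.X i, MvPolynomial.isWeightedHomogeneous_X K w i,
      (he _).trans (MvPolynomial.aeval_X x i)⟩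
  · rintro ℬ ⟨hgr, hint, hmem⟩
    -- Containment in one direction suffices, and it holds because ℬ is multiplicative and contains
    -- the generators in the right degrees.
    refine (hV.eq_of_le hint fun d => ?_).symm
    rintro _ ⟨p, hp, rfl⟩
    change e p ∈ ℬ d
    rw [he]
    exact MvPolynomial.aeval_mem_of_isWeightedHomogeneous ℬ hmem hp

theorem adjoin_jmMoment :
    Algebra.adjoin ℂ (Set.range fun k : {k : ℕ // 2 ≤ k} => jmMoment k) = ⊤ := by
  have htop : Algebra.adjoin ℂ (Set.range jmMoment) = ⊤ := by
    have h : Set.range jmMoment = Subtype.val ⁻¹' Set.range jmMomentInfty :=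
      Set.ext fun x =>
        ⟨fun ⟨k, hk⟩ => ⟨k, congrArg Subtype.val hk⟩, fun ⟨k, hk⟩ => ⟨k, Subtype.ext hk⟩⟩
    rw [h]
    exact Algebra.adjoin_adjoin_coe_preimage
  rw [eq_top_iff, ← htop, Algebra.adjoin_le_iff]
  rintro _ ⟨k, rfl⟩
  rcases Nat.lt_or_ge k 2 with hk | hk
  · interval_cases k
    · rw [jmMoment_zero]
      exact one_mem _
    · rw [jmMoment_one]
      exact zero_mem _
  · exact Algebra.subset_adjoin ⟨⟨k, hk⟩, rfl⟩

theorem mainTheorem11 :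
    AlgebraicIndependent ℂ (fun k : {k : ℕ // 2 ≤ k} => jmCumulant k) ∧
    AlgebraicIndependent ℂ (fun k : {k : ℕ // 2 ≤ k} => jmMoment k) ∧
    ∃! 𝒜 : ℕ → Submodule ℂ jmAlgebra,
      SetLike.GradedMonoid 𝒜 ∧ DirectSum.IsInternal 𝒜 ∧
        ∀ k : ℕ, 2 ≤ k → jmMoment k ∈ 𝒜 k ∧ jmMoment k ≠ 0 := by
  have hM := algebraicIndependent_of_hasLead hasLead_jmMoment_subtype
  refine ⟨algebraicIndependent_of_hasLead hasLead_jmCumulant_subtype, hM, ?_⟩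
  obtain ⟨𝒜, ⟨hgr, hint, hmem⟩, huniq⟩ :=
    existsUnique_gradation hM adjoin_jmMoment fun k => (k : ℕ)
  -- The moments are nonzero as members of an algebraically independent family.
  refine ⟨𝒜, ⟨hgr, hint, fun k hk => ⟨hmem ⟨k, hk⟩, hM.ne_zero ⟨k, hk⟩⟩⟩, ?_⟩
  rintro ℬ ⟨hgr', hint', hmem'⟩
  exact huniq ℬ ⟨hgr', hint', fun k => (hmem' k k.2).1⟩
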